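/- Let $0<\delta<1$ and $\varepsilon>0$. There is a constant $C_{\delta,\varepsilon}>0$, depending only on $\delta$ and $\varepsilon$, with the following property. For every dimension $d\ge 1$ and every $t>0$ there are two convex sets $X,Y\subset\mathbb{R}^d$, which can be taken to be closed half-spaces, such that $\mathrm{dist}(X,Y)=\delta t$ and $$\big\|\mathbf 1_Y\, e^{-it\langle\nabla\rangle}\,\mathbf 1_X\big\|_{\mathcal B(L^2(\mathbb{R}^d))}\ \ge\ 1-\varepsilon-\frac{C_{\delta,\varepsilon}}{t}.$$ Here $\mathrm{dist}(X,Y)=\inf\{|x-y| : x\in X,\ y\in Y\}$, $\mathbf 1_X$ and $\mathbf 1_Y$ are the operators on $L^2(\mathbb{R}^d)=L^2(\mathbb{R}^d;\mathbb{C})$ of multiplication by the characteristic functions of $X$ and $Y$, $e^{-it\langle\nabla\rangle}$ with $\langle\nabla\rangle=\sqrt{1-\Delta}$ is the free pseudo-relativistic evolution, i.e. the Fourier multiplier by $e^{-it\sqrt{1+|k|^2}}$, where $k$ is the Fourier variable for which $-i\nabla$ acts as multiplication by $k$, and $\|\cdot\|_{\mathcal B(L^2(\mathbb{R}^d))}$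 is the operator norm. -/

import Mathlib

open MeasureTheory
open scoped ENNReal

noncomputable section

namespace PseudoRel

/-- The Euclidean space `ℝ^d`. -/
abbrev Space (d : ℕ) : Type := EuclideanSpace ℝ (Fin d)

/-- The Hilbert space `L²(ℝ^d)` of complex-valued functions, for the Lebesgue measure. -/
abbrev L2 (d : ℕ) : Type := Lp (α := Space d) ℂ 2 (volume : Measure (Space d))

/-- The distance `inf {|x - y| : x ∈ X, y ∈ Y}` between two (nonempty) sets. -/
def setDist {d : ℕ} (X Y : Set (Space d)) : ℝ :=
  sInf {r : ℝ | ∃ x ∈ X, ∃ y ∈ Y, r = ‖x - y‖}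

/-- Closed half-spaces of `ℝ^d`: the sets `{x : ⟨n, x⟩ ≤ a}` with `n ≠ 0`. -/
def IsHalfSpace {d : ℕ} (S : Set (Space d)) : Prop :=
  ∃ n : Space d, n ≠ 0 ∧ ∃ a : ℝ, S = {x : Space d | inner ℝ n x ≤ a}

/-- The bounded operator on `L²(ℝ^d)` of pointwise multiplication by `m ∈ L^∞`. -/
def mulOp {d : ℕ} (m : Space d → ℂ) (hm : MemLp m ∞ (volume : Measure (Space d))) :
    L2 d →L[ℂ] L2 d :=
  (ContinuousLinearMap.mul ℂ ℂ).holderL volume ∞ 2 2 (hm.toLp m)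

theorem coeFn_mulOp {d : ℕ} (m : Space d → ℂ)
    (hm : MemLp m ∞ (volume : Measure (Space d))) (f : L2 d) :
    mulOp m hm f =ᵐ[volume] fun x => m x * f x := by
  have h := (ContinuousLinearMap.mul ℂ ℂ).coeFn_holder (r := 2) (hm.toLp m) f
  filter_upwards [h, hm.coeFn_toLp] with x hx hx'
  rw [← hx']
  exact hx

theorem memLp_indicator {d : ℕ} {S : Set (Space d)} (hS : MeasurableSet S) :
    MemLp (S.indicator fun _ => (1 : ℂ)) ∞ (volume : Measure (Space d)) :=
  (memLp_top_const 1).indicator hS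

/-- The operator `𝟏_S` on `L²(ℝ^d)`: multiplication by the indicator function of `S`. -/
def cutoff {d : ℕ} (S : Set (Space d)) (hS : MeasurableSet S) : L2 d →L[ℂ] L2 d :=
  mulOp (S.indicator fun _ => (1 : ℂ)) (memLp_indicator hS)

/-- `⟨ξ⟩ = √(1 + |ξ|²)`. -/
def bracket {d : ℕ} (ξ : Space d) : ℝ := Real.sqrt (1 + ‖ξ‖ ^ 2)

/-- The symbol of `e^{-it⟨∇⟩}`, `⟨∇⟩ = √(1 - Δ)`. In Mathlib's normalization
`𝓕 f ξ = ∫ e^{-2πi⟨x, ξ⟩} f x dx`, the operator `-i∇` is multiplication by `2πξ` on the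
Fourier side, so that `⟨∇⟩` is multiplication by `⟨2πξ⟩`. -/
def freeSymbol {d : ℕ} (t : ℝ) (ξ : Space d) : ℂ :=
  Complex.exp (-(Complex.I * t * bracket ((2 * Real.pi) • ξ)))

theorem memLp_freeSymbol {d : ℕ} (t : ℝ) :
    MemLp (freeSymbol (d := d) t) ∞ (volume : Measure (Space d)) := by
  refine memLp_top_of_bound (C := 1) ?_ (Filter.Eventually.of_forall fun ξ => ?_)
  · refine Continuous.aestronglyMeasurable ?_
    unfold freeSymbol bracket
    fun_prop
  · simp [freeSymbol, Complex.norm_exp]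

/-- The free evolution `e^{-it⟨∇⟩}` on `L²(ℝ^d)`, where `⟨∇⟩ = √(1 - Δ)`: the Fourier multiplier
with symbol `e^{-it⟨2πξ⟩}`. -/
def freeEvolution (d : ℕ) (t : ℝ) : L2 d →L[ℂ] L2 d :=
  ((Lp.fourierTransformₗᵢ (Space d) ℂ).symm.toContinuousLinearEquiv : L2 d →L[ℂ] L2 d) ∘L
    mulOp (freeSymbol t) (memLp_freeSymbol t) ∘L
      ((Lp.fourierTransformₗᵢ (Space d) ℂ).toContinuousLinearEquiv : L2 d →L[ℂ] L2 d)

end PseudoRel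

end

noncomputable section

namespace PseudoRel

open FourierTransform Real

/-! ### Fourier transform and norms in L² -/

section L2

variable {d : ℕ}

/-! A wave packet of momentum `p` travels at group velocity `p / ⟨p⟩`, which takes every speed below
1. Choose speed `(1 + δ) / 2` and start at depth `M = (1 - δ)t / 4` inside `X = {x_j ≤ 0}`: at time
`t` the centre is at depth `M` inside `Y = {x_j ≥ δt}`. A Gaussian with inverse square widths `b` of
order `η / t` does the rest. The free phase differs from its linearization at `p`, which merely
translates the packet, by at most `t|k - p|² / 2`; this costs `O(t ∑ bᵢ) = O(η)` in squared norm
(`freeEvolution_packetLp_sub`). The mass cut off at distance `M` is `O(1 / (b_j M²)) = O(1 / (ηt))`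
(`packetLp_sub_cutoff`). So `η` is fixed by `ε` and `t` must be large; for smaller `t` the bound is
trivial. -/

theorem fourierTransformₗᵢ_toLp {f g : Space d → ℂ} (hf1 : Integrable f)
    (hf : MemLp f 2 volume) (hg : MemLp g 2 volume) (hfg : ∀ ξ, 𝓕 f ξ = g ξ) :
    Lp.fourierTransformₗᵢ (Space d) ℂ (hf.toLp f) = hg.toLp g := by
  -- The L² transform agrees with the distributional one, so it suffices to test against Schwartz
  -- `φ` and move the Fourier integral from `φ` to `f`.
  have h := Lp.fourier_toTemperedDistribution_eq (hf.toLp f)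
  change _ = Lp.toTemperedDistribution (Lp.fourierTransformₗᵢ (Space d) ℂ (hf.toLp f)) at h
  have hinj : Function.Injective (Lp.toTemperedDistributionCLM ℂ (volume : Measure (Space d)) 2) :=
    LinearMap.ker_eq_bot.mp Lp.ker_toTemperedDistributionCLM_eq_bot
  apply hinj
  simp only [Lp.toTemperedDistributionCLM_apply]
  rw [← h]
  ext φ
  rw [TemperedDistribution.fourier_apply, Lp.toTemperedDistribution_apply,
    Lp.toTemperedDistribution_apply]
  have h1 : ∫ x, (𝓕 φ) x • (hf.toLp f) x = ∫ x, (𝓕 φ) x • f x :=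
    integral_congr_ae (by filter_upwards [hf.coeFn_toLp] with x hx; rw [hx])
  have h2 : ∫ x, φ x • (hg.toLp g) x = ∫ x, φ x • g x :=
    integral_congr_ae (by filter_upwards [hg.coeFn_toLp] with x hx; rw [hx])
  rw [h1, h2]
  have h3 := VectorFourier.integral_fourierIntegral_smul_eq_flip (L := innerₗ (Space d))
    (μ := volume) (ν := volume) Real.continuous_fourierChar continuous_inner
    φ.integrable hf1
  rw [flip_innerₗ] at h3
  have h4 : ∀ x, VectorFourier.fourierIntegral 𝐞 volume (innerₗ (Space d)) f x = g x := hfg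
  simp only [h4] at h3
  exact h3

theorem norm_sq_eq_integral (F : L2 d) : ‖F‖ ^ 2 = ∫ x, ‖F x‖ ^ 2 := by
  rw [← inner_self_eq_norm_sq (𝕜 := ℂ), L2.inner_def, ← integral_re (L2.integrable_inner F F)]
  simp only [inner_self_eq_norm_sq]

theorem norm_toLp_sq {f : Space d → ℂ} (hf : MemLp f 2 volume) :
    ‖hf.toLp f‖ ^ 2 = ∫ x, ‖f x‖ ^ 2 := by
  rw [norm_sq_eq_integral]
  exact integral_congr_ae (by filter_upwards [hf.coeFn_toLp] with x hx; rw [hx])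

theorem norm_sq_le_integral {F : L2 d} {ρ : Space d → ℝ} (hρ : Integrable ρ)
    (h : ∀ᵐ x, ‖F x‖ ^ 2 ≤ ρ x) : ‖F‖ ^ 2 ≤ ∫ x, ρ x := by
  rw [norm_sq_eq_integral]
  exact integral_mono_of_nonneg (.of_forall fun _ => by positivity) hρ h

theorem norm_cutoff_apply_le {S : Set (Space d)} (hS : MeasurableSet S) (F : L2 d) :
    ‖cutoff S hS F‖ ≤ ‖F‖ := by
  refine Lp.norm_le_norm_of_ae_le ?_
  filter_upwards [coeFn_mulOp _ (memLp_indicator hS) F] with x hx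
  rw [cutoff, hx]
  by_cases hxS : x ∈ S <;> simp [hxS]

end L2

/-! ### Anisotropic Gaussians and their second moments -/

section Gaussian

variable {d : ℕ}

/-- The Gaussian `exp (-∑ cᵢ xᵢ²)`. -/
def gauss (c : Fin d → ℝ) (x : Space d) : ℝ := Real.exp (-∑ i, c i * x i ^ 2)

theorem gauss_pos (c : Fin d → ℝ) (x : Space d) : 0 < gauss c x := Real.exp_pos _

@[fun_prop]
theorem continuous_gauss (c : Fin d → ℝ) : Continuous (gauss c) := by
  unfold gauss; fun_prop

theorem gauss_sq (c : Fin d → ℝ) (x : Space d) : gauss c x ^ 2 = gauss (fun i => 2 * c i) x := by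
  simp only [gauss, ← Real.exp_nat_mul]
  congr 1
  simp [Finset.mul_sum, mul_assoc]

theorem gauss_eq_prod (c : Fin d → ℝ) (x : Space d) :
    gauss c x = ∏ i, Real.exp (-c i * x i ^ 2) := by
  rw [gauss, ← Finset.sum_neg_distrib, Real.exp_sum]
  simp

theorem integrable_gauss {c : Fin d → ℝ} (hc : ∀ i, 0 < c i) : Integrable (gauss c) := by
  rw [← (PiLp.volume_preserving_toLp (Fin d)).integrable_comp_emb
    (MeasurableEquiv.toLp 2 _).measurableEmbedding]
  simp only [Function.comp_def, gauss_eq_prod]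
  exact Integrable.fintype_prod (f := fun i (v : ℝ) ↦ Real.exp (-c i * v ^ 2))
    fun i => integrable_exp_neg_mul_sq (hc i)

theorem integral_gauss (c : Fin d → ℝ) : ∫ x, gauss c x = ∏ i, √(π / c i) := by
  rw [← (PiLp.volume_preserving_toLp (Fin d)).integral_comp
    (MeasurableEquiv.toLp 2 _).measurableEmbedding]
  simp only [gauss_eq_prod]
  rw [integral_fintype_prod_volume_eq_prod (f := fun i (v : ℝ) ↦ Real.exp (-c i * v ^ 2))]
  simp only [integral_gaussian]

/-- Half of the decay in coordinate `j` absorbs the square, by `u ≤ exp u`. -/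
theorem sq_mul_gauss_le {c : Fin d → ℝ} {j : Fin d} (hj : 0 < c j) (x : Space d) :
    x j ^ 2 * gauss c x ≤ 2 / c j * gauss (Function.update c j (c j / 2)) x := by
  have h1 : gauss c x = gauss (Function.update c j (c j / 2)) x * Real.exp (-(c j / 2 * x j ^ 2)) := by
    rw [gauss, gauss, ← Real.exp_add]
    congr 1
    rw [← Finset.add_sum_erase _ _ (Finset.mem_univ j),
      ← Finset.add_sum_erase _ (fun i => Function.update c j (c j / 2) i * x i ^ 2)
        (Finset.mem_univ j),
      Finset.sum_congr rfl (g := fun i => Function.update c j (c j / 2) i * x i ^ 2)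
        (fun i hi => by rw [Function.update_of_ne (Finset.ne_of_mem_erase hi)])]
    simp only [Function.update_self]
    ring
  have h2 : x j ^ 2 * Real.exp (-(c j / 2 * x j ^ 2)) ≤ 2 / c j := by
    rw [Real.exp_neg, ← div_eq_mul_inv, div_le_iff₀ (Real.exp_pos _)]
    have := Real.add_one_le_exp (c j / 2 * x j ^ 2)
    calc x j ^ 2 = 2 / c j * (c j / 2 * x j ^ 2) := by field_simp
      _ ≤ _ := by gcongr; linarith
  rw [h1]
  nlinarith [gauss_pos (Function.update c j (c j / 2)) x]

theorem update_half_pos {c : Fin d → ℝ} (hc : ∀ i, 0 < c i) (j : Fin d) (i : Fin d) :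
    0 < Function.update c j (c j / 2) i := by
  by_cases h : i = j
  · subst h; simp [hc]
  · simp [h, hc]

theorem integrable_sq_mul_gauss {c : Fin d → ℝ} (hc : ∀ i, 0 < c i) (j : Fin d) :
    Integrable fun x : Space d => x j ^ 2 * gauss c x := by
  refine ((integrable_gauss (update_half_pos hc j)).const_mul (2 / c j)).mono'
    (by fun_prop) (.of_forall fun x => ?_)
  rw [Real.norm_of_nonneg (mul_nonneg (sq_nonneg _) (gauss_pos _ _).le)]
  exact sq_mul_gauss_le (hc j) x

/-- Halving `c j` costs a factor `√2 ≤ 2`. The constant is not sharp; only the order `1 / c j`,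
uniform in `d`, matters. -/
theorem integral_sq_mul_gauss_le {c : Fin d → ℝ} (hc : ∀ i, 0 < c i) (j : Fin d) :
    ∫ x : Space d, x j ^ 2 * gauss c x ≤ 4 / c j * ∫ x, gauss c x := by
  have h1 : ∫ x : Space d, x j ^ 2 * gauss c x ≤
      ∫ x : Space d, 2 / c j * gauss (Function.update c j (c j / 2)) x :=
    integral_mono (integrable_sq_mul_gauss hc j)
      ((integrable_gauss (update_half_pos hc j)).const_mul _) (sq_mul_gauss_le (hc j))
  refine h1.trans ?_
  have h2 : ∫ x, gauss (Function.update c j (c j / 2)) x = √2 * ∫ x, gauss c x := by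
    rw [integral_gauss, integral_gauss, ← Finset.mul_prod_erase _ _ (Finset.mem_univ j),
      ← Finset.mul_prod_erase _ (fun i => √(π / c i)) (Finset.mem_univ j),
      Finset.prod_congr rfl (g := fun i => √(π / c i))
        (fun i hi => by rw [Function.update_of_ne (Finset.ne_of_mem_erase hi)]),
      ← mul_assoc, ← Real.sqrt_mul zero_le_two, Function.update_self]
    congr 3
    field_simp
  have h3 : √2 ≤ 2 := Real.sqrt_le_left zero_le_two |>.mpr (by norm_num)
  have h4 : 0 ≤ ∫ x, gauss c x := integral_nonneg fun x => (gauss_pos c x).le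
  have h5 := hc j
  rw [integral_const_mul, h2]
  calc 2 / c j * (√2 * ∫ x, gauss c x) ≤ 2 / c j * (2 * ∫ x, gauss c x) := by gcongr
    _ = _ := by ring

end Gaussian

/-! ### Gaussian wave packets and their Fourier transforms -/

section Packet

variable {d : ℕ}

/-- The Gaussian wave packet centred at `a`, with frequency `κ` and inverse square widths `b`. -/
def packet (b : Fin d → ℝ) (κ a x : Space d) : ℂ :=
  Complex.exp (2 * π * Complex.I * (inner ℝ κ x : ℝ)) * gauss b (x - a)

/-- The Fourier transform of `packet b κ a`. -/
def packetFourier (b : Fin d → ℝ) (κ a ξ : Space d) : ℂ :=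
  Complex.exp (-(2 * π * Complex.I * (inner ℝ (ξ - κ) a : ℝ))) *
    ((∏ i, (π / b i : ℂ) ^ (1 / 2 : ℂ)) * gauss (fun i => π ^ 2 / b i) (ξ - κ))

theorem continuous_packet (b : Fin d → ℝ) (κ a : Space d) : Continuous (packet b κ a) := by
  unfold packet; fun_prop

theorem continuous_packetFourier (b : Fin d → ℝ) (κ a : Space d) :
    Continuous (packetFourier b κ a) := by
  unfold packetFourier; fun_prop

theorem norm_exp_mul_I_real (r : ℝ) : ‖Complex.exp (2 * π * Complex.I * r)‖ = 1 := by
  simp [Complex.norm_exp]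

theorem norm_packet (b : Fin d → ℝ) (κ a x : Space d) : ‖packet b κ a x‖ = gauss b (x - a) := by
  rw [packet, norm_mul, norm_exp_mul_I_real, one_mul, Complex.norm_real,
    Real.norm_of_nonneg (gauss_pos _ _).le]

theorem norm_packetFourier (b : Fin d → ℝ) (κ a ξ : Space d) :
    ‖packetFourier b κ a ξ‖ =
      ‖∏ i, (π / b i : ℂ) ^ (1 / 2 : ℂ)‖ * gauss (fun i => π ^ 2 / b i) (ξ - κ) := by
  rw [packetFourier, norm_mul, norm_mul, Complex.norm_real,
    Real.norm_of_nonneg (gauss_pos _ _).le]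
  simp [Complex.norm_exp]

variable {b : Fin d → ℝ} (hb : ∀ i, 0 < b i) (κ a : Space d)

include hb

theorem two_mul_pos_of_pos (i : Fin d) : 0 < 2 * b i := by have := hb i; positivity

theorem two_mul_pi_sq_div_pos (i : Fin d) : 0 < 2 * (π ^ 2 / b i) := by
  have := hb i; positivity

theorem integrable_packet : Integrable (packet b κ a) :=
  ((integrable_gauss hb).comp_sub_right a).mono'
    (continuous_packet b κ a).aestronglyMeasurable (.of_forall fun x => (norm_packet b κ a x).le)

theorem memLp_packet : MemLp (packet b κ a) 2 volume := by
  rw [memLp_two_iff_integrable_sq_norm (continuous_packet b κ a).aestronglyMeasurable]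
  simp only [norm_packet, gauss_sq]
  exact (integrable_gauss (two_mul_pos_of_pos hb)).comp_sub_right a

theorem memLp_packetFourier : MemLp (packetFourier b κ a) 2 volume := by
  rw [memLp_two_iff_integrable_sq_norm (continuous_packetFourier b κ a).aestronglyMeasurable]
  simp only [norm_packetFourier, mul_pow, gauss_sq]
  exact ((integrable_gauss (two_mul_pi_sq_div_pos hb)).comp_sub_right κ).const_mul _

theorem fourier_packet (ξ : Space d) : 𝓕 (packet b κ a) ξ = packetFourier b κ a ξ := by
  rw [Real.fourier_eq', ← integral_add_right_eq_self _ a]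
  have h1 : ∀ x : Space d, Complex.exp (↑(-2 * π * inner ℝ (x + a) ξ) * Complex.I) •
      packet b κ a (x + a) = Complex.exp (-(2 * π * Complex.I * (inner ℝ (ξ - κ) a : ℝ))) *
        Complex.exp (-∑ i, (b i : ℂ) * (x i : ℂ) ^ 2 +
          ∑ i, (2 * π * Complex.I * (κ i - ξ i)) * x i) := by
    intro x
    rw [packet, add_sub_cancel_right, gauss, Complex.ofReal_exp, smul_eq_mul,
      ← Complex.exp_add, ← Complex.exp_add, ← Complex.exp_add]
    congr 1
    simp only [mul_assoc, ← Finset.mul_sum]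
    simp only [inner_add_left, inner_add_right, inner_sub_left, real_inner_comm a ξ]
    simp only [PiLp.inner_apply, RCLike.inner_apply, conj_trivial]
    push_cast
    simp only [sub_mul, Finset.sum_sub_distrib]
    simp only [mul_comm (ξ _ : ℂ) (x _ : ℂ), mul_comm (κ _ : ℂ) (x _ : ℂ)]
    ring
  simp only [h1]
  rw [integral_const_mul, packetFourier]
  congr 1
  rw [← (PiLp.volume_preserving_toLp (Fin d)).integral_comp
    (MeasurableEquiv.toLp 2 _).measurableEmbedding]
  have h2 := GaussianFourier.integral_cexp_neg_sum_mul_add (b := fun i => (b i : ℂ))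
    (by simpa using hb) (fun i => 2 * π * Complex.I * (κ i - ξ i))
  refine h2.trans ?_
  rw [Finset.prod_mul_distrib, ← Complex.exp_sum, gauss, Complex.ofReal_exp]
  congr 2
  push_cast
  rw [← Finset.sum_neg_distrib]
  refine Finset.sum_congr rfl fun i _ => ?_
  have : (b i : ℂ) ≠ 0 := by exact_mod_cast (hb i).ne'
  rw [mul_pow, mul_pow, Complex.I_sq]
  simp only [PiLp.sub_apply]
  push_cast
  field_simp
  ring

/-- The class in `L²` of `packet b κ a`. -/
def packetLp : L2 d := (memLp_packet hb κ a).toLp (packet b κ a)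

theorem fourierTransformₗᵢ_packetLp : Lp.fourierTransformₗᵢ (Space d) ℂ (packetLp hb κ a) =
    (memLp_packetFourier hb κ a).toLp (packetFourier b κ a) :=
  fourierTransformₗᵢ_toLp (integrable_packet hb κ a) _ _ (fourier_packet hb κ a)

theorem norm_packetLp_sq : ‖packetLp hb κ a‖ ^ 2 = ∫ x, gauss (fun i => 2 * b i) x := by
  rw [packetLp, norm_toLp_sq]
  simp only [norm_packet, gauss_sq]
  exact integral_sub_right_eq_self (gauss fun i => 2 * b i) a

/-- Plancherel: the mass read off in frequency space, so the prefactor never has to be evaluated. -/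
theorem norm_packetLp_sq' : ‖packetLp hb κ a‖ ^ 2 =
    ‖∏ i, (π / b i : ℂ) ^ (1 / 2 : ℂ)‖ ^ 2 * ∫ x, gauss (fun i => 2 * (π ^ 2 / b i)) x := by
  rw [← (Lp.fourierTransformₗᵢ (Space d) ℂ).norm_map, fourierTransformₗᵢ_packetLp, norm_toLp_sq]
  simp only [norm_packetFourier, mul_pow, gauss_sq]
  rw [integral_const_mul, integral_sub_right_eq_self (gauss fun i => 2 * (π ^ 2 / b i)) κ]

theorem norm_packetLp_pos : 0 < ‖packetLp hb κ a‖ := by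
  have h : 0 < ‖packetLp hb κ a‖ ^ 2 := by
    rw [norm_packetLp_sq, integral_gauss]
    exact Finset.prod_pos fun i _ => Real.sqrt_pos.mpr (by have := hb i; positivity)
  exact (norm_nonneg _).lt_of_ne' fun h0 => by simp [h0] at h

theorem norm_packetLp_eq (a' : Space d) : ‖packetLp hb κ a‖ = ‖packetLp hb κ a'‖ := by
  rw [← sq_eq_sq₀ (norm_nonneg _) (norm_nonneg _), norm_packetLp_sq, norm_packetLp_sq]

end Packet

/-! ### Transport of packets and losses from cutoffs -/

section Evolution

variable {d : ℕ}

theorem bracket_pos (k : Space d) : 0 < bracket k := Real.sqrt_pos.mpr (by positivity)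

theorem bracket_sq (k : Space d) : bracket k ^ 2 = 1 + ‖k‖ ^ 2 := Real.sq_sqrt (by positivity)

theorem one_le_bracket (k : Space d) : 1 ≤ bracket k := by
  rw [bracket, Real.one_le_sqrt]; nlinarith [sq_nonneg ‖k‖]

/-- The remainder times `⟨p⟩` is `⟨k⟩⟨p⟩ - 1 - p·k`: nonnegative by Cauchy–Schwarz, and equal to
half of `|k - p|² - (⟨k⟩ - ⟨p⟩)²`. Conclude with `⟨p⟩ ≥ 1`. -/
theorem abs_bracket_sub_linear_le (p k : Space d) :
    |bracket k - bracket p - inner ℝ p (k - p) / bracket p| ≤ ‖k - p‖ ^ 2 / 2 := by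
  have hw := bracket_pos p
  have hw1 := one_le_bracket p
  have hk := bracket_pos k
  have hw2 := bracket_sq p
  have hk2 := bracket_sq k
  have hn : ‖k - p‖ ^ 2 = ‖k‖ ^ 2 - 2 * inner ℝ p k + ‖p‖ ^ 2 := by
    rw [norm_sub_sq_real, real_inner_comm]
  have hi : (inner ℝ p (k - p) : ℝ) = inner ℝ p k - ‖p‖ ^ 2 := by
    rw [inner_sub_right, real_inner_self_eq_norm_sq]
  have hcs : (inner ℝ p k : ℝ) ≤ ‖p‖ * ‖k‖ := real_inner_le_norm p k
  have hlow : 1 + ‖p‖ * ‖k‖ ≤ bracket k * bracket p := by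
    refine abs_le_of_sq_le_sq' ?_ (by positivity) |>.2
    rw [mul_pow, hw2, hk2]
    nlinarith [sq_nonneg (‖p‖ - ‖k‖)]
  have hval : bracket k - bracket p - inner ℝ p (k - p) / bracket p =
      (bracket k * bracket p - (1 + inner ℝ p k)) / bracket p := by
    rw [hi]; field_simp; linear_combination -hw2
  rw [hval, abs_of_nonneg (div_nonneg (by linarith) hw.le), div_le_iff₀ hw]
  nlinarith [sq_nonneg (bracket k - bracket p), sq_nonneg ‖k - p‖]

/-- Product of the bounds `|θ|` and `2`. Being linear in `θ`, it requires only second moments of the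
packet later. -/
theorem norm_exp_mul_I_sub_one_sq_le (θ : ℝ) :
    ‖Complex.exp (Complex.I * θ) - 1‖ ^ 2 ≤ 2 * |θ| := by
  have h1 := Real.norm_exp_I_mul_ofReal_sub_one_le (x := θ)
  have h2 : ‖Complex.exp (Complex.I * θ) - 1‖ ≤ 2 := by
    refine (norm_sub_le _ _).trans ?_
    rw [mul_comm, Complex.norm_exp_ofReal_mul_I]; norm_num
  rw [Real.norm_eq_abs] at h1
  nlinarith [norm_nonneg (Complex.exp (Complex.I * θ) - 1)]

theorem fourierTransformₗᵢ_freeEvolution (t : ℝ) (F : L2 d) :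
    Lp.fourierTransformₗᵢ (Space d) ℂ (freeEvolution d t F) =
      mulOp (freeSymbol t) (memLp_freeSymbol t) (Lp.fourierTransformₗᵢ (Space d) ℂ F) :=
  (Lp.fourierTransformₗᵢ (Space d) ℂ).apply_symm_apply _

theorem norm_freeEvolution_apply_le (t : ℝ) (F : L2 d) : ‖freeEvolution d t F‖ ≤ ‖F‖ := by
  rw [← (Lp.fourierTransformₗᵢ (Space d) ℂ).norm_map, fourierTransformₗᵢ_freeEvolution,
    ← (Lp.fourierTransformₗᵢ (Space d) ℂ).norm_map F]
  refine Lp.norm_le_norm_of_ae_le ?_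
  filter_upwards [coeFn_mulOp _ (memLp_freeSymbol t) (Lp.fourierTransformₗᵢ (Space d) ℂ F)]
    with x hx
  rw [hx, norm_mul]
  simp [freeSymbol, Complex.norm_exp]

/-- In the expansion of the phase at `p = 2πκ`, the constant term is a global phase and the linear
term translates the packet by `t p / ⟨p⟩`; only the quadratic remainder `θ` is an error. -/
theorem freeSymbol_mul_packetFourier_sub (b : Fin d → ℝ) {t : ℝ} (ht : 0 ≤ t)
    (κ a ξ : Space d) :
    ‖freeSymbol t ξ * packetFourier b κ a ξ -
      Complex.exp (-(Complex.I * t * bracket ((2 * π) • κ))) *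
        packetFourier b κ (a + (t / bracket ((2 * π) • κ)) • (2 * π) • κ) ξ‖ ^ 2 ≤
    4 * π ^ 2 * t * ‖ξ - κ‖ ^ 2 * ‖packetFourier b κ a ξ‖ ^ 2 := by
  set p := (2 * π) • κ with hp
  set k := (2 * π) • ξ with hk
  set θ : ℝ := -(t * (bracket k - bracket p - inner ℝ p (k - p) / bracket p)) with hθ
  have hin : (inner ℝ p (k - p) : ℝ) = 2 * π * inner ℝ (ξ - κ) p := by
    rw [hk, hp, ← smul_sub, inner_smul_right, real_inner_comm]
  have hw := (bracket_pos p).ne'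
  have h1 : freeSymbol t ξ * packetFourier b κ a ξ -
      Complex.exp (-(Complex.I * t * bracket p)) *
        packetFourier b κ (a + (t / bracket p) • p) ξ =
      Complex.exp (-(Complex.I * t * bracket p)) *
        packetFourier b κ (a + (t / bracket p) • p) ξ * (Complex.exp (Complex.I * θ) - 1) := by
    rw [mul_sub, mul_one, sub_left_inj, packetFourier, packetFourier, freeSymbol]
    simp only [← mul_assoc]
    rw [mul_right_comm _ _ (Complex.exp (Complex.I * θ)),
      mul_right_comm _ _ (Complex.exp (Complex.I * θ))]
    simp only [← Complex.exp_add]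
    congr 3
    rw [inner_add_right, inner_smul_right, hθ, hin]
    push_cast
    ring
  have h2 : ‖packetFourier b κ (a + (t / bracket p) • p) ξ‖ = ‖packetFourier b κ a ξ‖ := by
    rw [norm_packetFourier, norm_packetFourier]
  have h3 : ‖Complex.exp (-(Complex.I * t * bracket p))‖ = 1 := by simp [Complex.norm_exp]
  have h4 : |θ| ≤ t * ((4 * π ^ 2 * ‖ξ - κ‖ ^ 2) / 2) := by
    rw [hθ, abs_neg, abs_mul, abs_of_nonneg ht]
    have h5 := abs_bracket_sub_linear_le p k
    have h6 : ‖k - p‖ ^ 2 = 4 * π ^ 2 * ‖ξ - κ‖ ^ 2 := by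
      rw [hk, hp, ← smul_sub, norm_smul, Real.norm_of_nonneg (by positivity)]; ring
    rw [h6] at h5
    gcongr
  rw [h1, norm_mul, norm_mul, h2, h3, one_mul, mul_pow, mul_comm]
  gcongr
  have := norm_exp_mul_I_sub_one_sq_le θ
  linarith

theorem freeEvolution_packetLp_sub {b : Fin d → ℝ} (hb : ∀ i, 0 < b i) {t : ℝ} (ht : 0 ≤ t)
    (κ a : Space d) :
    ‖freeEvolution d t (packetLp hb κ a) -
      Complex.exp (-(Complex.I * t * bracket ((2 * π) • κ))) •
        packetLp hb κ (a + (t / bracket ((2 * π) • κ)) • (2 * π) • κ)‖ ^ 2 ≤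
    8 * t * (∑ i, b i) * ‖packetLp hb κ a‖ ^ 2 := by
  set K := ‖∏ i, (π / b i : ℂ) ^ (1 / 2 : ℂ)‖
  set g := gauss (d := d) fun i => 2 * (π ^ 2 / b i) with hg
  have hint : ∀ j, Integrable fun x : Space d => x j ^ 2 * g x := fun j =>
    integrable_sq_mul_gauss (two_mul_pi_sq_div_pos hb) j
  have hint' : Integrable fun x : Space d => 4 * π ^ 2 * t * K ^ 2 * ∑ j, x j ^ 2 * g x :=
    (integrable_finsetSum _ fun j _ => hint j).const_mul _
  rw [← (Lp.fourierTransformₗᵢ (Space d) ℂ).norm_map, map_sub, map_smul,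
    fourierTransformₗᵢ_freeEvolution, fourierTransformₗᵢ_packetLp, fourierTransformₗᵢ_packetLp]
  refine (norm_sq_le_integral (hint'.comp_sub_right κ) ?_).trans ?_
  · filter_upwards [coeFn_mulOp _ (memLp_freeSymbol t)
        ((memLp_packetFourier hb κ a).toLp (packetFourier b κ a)),
      (memLp_packetFourier hb κ a).coeFn_toLp,
      (memLp_packetFourier hb κ
        (a + (t / bracket ((2 * π) • κ)) • (2 * π) • κ)).coeFn_toLp,
      Lp.coeFn_sub (mulOp (freeSymbol t) (memLp_freeSymbol t)
          ((memLp_packetFourier hb κ a).toLp (packetFourier b κ a)))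
        (Complex.exp (-(Complex.I * t * bracket ((2 * π) • κ))) •
          (memLp_packetFourier hb κ
            (a + (t / bracket ((2 * π) • κ)) • (2 * π) • κ)).toLp _),
      Lp.coeFn_smul (Complex.exp (-(Complex.I * t * bracket ((2 * π) • κ))))
          ((memLp_packetFourier hb κ
            (a + (t / bracket ((2 * π) • κ)) • (2 * π) • κ)).toLp _)]
      with ξ h1 h2 h3 h4 h5
    rw [h4, Pi.sub_apply, h1, h2, h5, Pi.smul_apply, h3, smul_eq_mul]
    refine (freeSymbol_mul_packetFourier_sub b ht κ a ξ).trans (le_of_eq ?_)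
    rw [norm_packetFourier, mul_pow, gauss_sq, ← Finset.sum_mul, EuclideanSpace.norm_sq_eq]
    simp only [Real.norm_eq_abs, sq_abs]
    ring
  · rw [integral_sub_right_eq_self
      (fun x : Space d => 4 * π ^ 2 * t * K ^ 2 * ∑ j, x j ^ 2 * g x) κ,
      integral_const_mul, integral_finsetSum _ fun j _ => hint j, norm_packetLp_sq']
    have hsum : ∑ j, ∫ x : Space d, x j ^ 2 * g x ≤ ∑ j, 2 * b j / π ^ 2 * ∫ x, g x := by
      refine Finset.sum_le_sum fun j _ => ?_
      refine (integral_sq_mul_gauss_le (two_mul_pi_sq_div_pos hb) j).trans (le_of_eq ?_)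
      have := (hb j).ne'
      rw [hg]
      congr 1
      field_simp
      norm_num
    calc 4 * π ^ 2 * t * K ^ 2 * ∑ j, ∫ x : Space d, x j ^ 2 * g x
        ≤ 4 * π ^ 2 * t * K ^ 2 * ∑ j, 2 * b j / π ^ 2 * ∫ x, g x := by gcongr
      _ = 8 * t * (∑ i, b i) * (K ^ 2 * ∫ x, g x) := by
        simp only [mul_div_assoc, mul_assoc, ← Finset.mul_sum, ← Finset.sum_mul,
          div_mul_eq_mul_div]
        field_simp
        ring

/-- Chebyshev's inequality in coordinate `j` for the density `|packet|²`. -/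
theorem packetLp_sub_cutoff {b : Fin d → ℝ} (hb : ∀ i, 0 < b i) (κ a : Space d)
    {S : Set (Space d)} (hS : MeasurableSet S) {j : Fin d} {M : ℝ} (hM : 0 < M)
    (h : ∀ x ∉ S, M ≤ |x j - a j|) :
    ‖packetLp hb κ a - cutoff S hS (packetLp hb κ a)‖ ^ 2 ≤
      2 / (b j * M ^ 2) * ‖packetLp hb κ a‖ ^ 2 := by
  set g := gauss (d := d) fun i => 2 * b i with hg
  have hint : Integrable fun x : Space d => 1 / M ^ 2 * (x j ^ 2 * g x) :=
    (integrable_sq_mul_gauss (two_mul_pos_of_pos hb) j).const_mul _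
  refine (norm_sq_le_integral (hint.comp_sub_right a) ?_).trans ?_
  · filter_upwards [coeFn_mulOp _ (memLp_indicator hS) (packetLp hb κ a),
      Lp.coeFn_sub (packetLp hb κ a) (cutoff S hS (packetLp hb κ a)),
      (memLp_packet hb κ a).coeFn_toLp] with x h1 h2 h3
    have h3' : packetLp hb κ a x = packet b κ a x := h3
    rw [h2, Pi.sub_apply, cutoff, h1, h3']
    have hpos := gauss_pos (fun i => 2 * b i) (x - a)
    by_cases hx : x ∈ S
    · simp only [hx, Set.indicator_of_mem, one_mul, sub_self, norm_zero,
        ne_eq, OfNat.ofNat_ne_zero, not_false_eq_true, zero_pow]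
      exact mul_nonneg (by positivity) (mul_nonneg (sq_nonneg _) hpos.le)
    · simp only [hx, not_false_eq_true, Set.indicator_of_notMem, zero_mul, sub_zero]
      rw [norm_packet, gauss_sq, ← mul_assoc]
      refine le_mul_of_one_le_left hpos.le ?_
      rw [one_div_mul_eq_div, one_le_div (by positivity), ← sq_abs ((x - a) j)]
      exact pow_le_pow_left₀ hM.le (h x hx) 2
  · rw [integral_sub_right_eq_self (fun x : Space d => 1 / M ^ 2 * (x j ^ 2 * g x)) a,
      integral_const_mul, norm_packetLp_sq]
    have h5 := hb j
    calc 1 / M ^ 2 * ∫ x : Space d, x j ^ 2 * g x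
        ≤ 1 / M ^ 2 * (4 / (2 * b j) * ∫ x, g x) := by
          gcongr; exact integral_sq_mul_gauss_le (two_mul_pos_of_pos hb) j
      _ = _ := by field_simp; ring

end Evolution

/-! ### Coordinate half-spaces -/

section HalfSpace

variable {d : ℕ} (j : Fin d)

theorem isHalfSpace_coord_le (r : ℝ) : IsHalfSpace {x : Space d | x j ≤ r} :=
  ⟨EuclideanSpace.single j 1, by simp, r, by ext x; simp [EuclideanSpace.inner_single_left]⟩

theorem isHalfSpace_le_coord (r : ℝ) : IsHalfSpace {x : Space d | r ≤ x j} :=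
  ⟨-EuclideanSpace.single j 1, by simp, -r, by
    ext x; simp [EuclideanSpace.inner_single_left]⟩

theorem IsHalfSpace.convex {S : Set (Space d)} (hS : IsHalfSpace S) : Convex ℝ S := by
  obtain ⟨n, -, a, rfl⟩ := hS
  exact convex_halfSpace_le (innerₗ (Space d) n).isLinear a

theorem IsHalfSpace.measurableSet {S : Set (Space d)} (hS : IsHalfSpace S) : MeasurableSet S := by
  obtain ⟨n, -, a, rfl⟩ := hS
  exact (isClosed_le (by fun_prop) continuous_const).measurableSet

theorem setDist_coord {r : ℝ} (hr : 0 ≤ r) :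
    setDist {x : Space d | x j ≤ 0} {x : Space d | r ≤ x j} = r := by
  refine IsLeast.csInf_eq ⟨⟨0, by simp, EuclideanSpace.single j r, by simp, ?_⟩, ?_⟩
  · simp [abs_of_nonneg hr]
  · rintro _ ⟨x, hx, y, hy, rfl⟩
    have h := PiLp.norm_apply_le (x - y) j
    rw [PiLp.sub_apply, Real.norm_eq_abs, abs_sub_comm] at h
    simp only [Set.mem_ofPred_eq] at hx hy
    linarith [le_abs_self (y j - x j)]

end HalfSpace

/-! ### Choice of parameters and conclusion -/

theorem le_norm_cutoff_freeEvolution_cutoff {d : ℕ} {X Y : Set (Space d)} (hX : MeasurableSet X)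
    (hY : MeasurableSet Y) {t α β γ : ℝ} {f h : L2 d} {c : ℂ} (hc : ‖c‖ = 1) (hf : 0 < ‖f‖)
    (hh : ‖h‖ = ‖f‖) (hα : ‖f - cutoff X hX f‖ ≤ α * ‖f‖)
    (hβ : ‖freeEvolution d t f - c • h‖ ≤ β * ‖f‖) (hγ : ‖h - cutoff Y hY h‖ ≤ γ * ‖f‖) :
    1 - α - β - γ ≤ ‖cutoff Y hY ∘L freeEvolution d t ∘L cutoff X hX‖ := by
  have key : c • h - (cutoff Y hY ∘L freeEvolution d t ∘L cutoff X hX) f =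
      c • (h - cutoff Y hY h) - cutoff Y hY (freeEvolution d t f - c • h) +
        cutoff Y hY (freeEvolution d t (f - cutoff X hX f)) := by
    simp only [ContinuousLinearMap.comp_apply, map_sub, map_smul, smul_sub]
    abel
  have h1 : ‖c • h - (cutoff Y hY ∘L freeEvolution d t ∘L cutoff X hX) f‖ ≤
      γ * ‖f‖ + β * ‖f‖ + α * ‖f‖ := by
    rw [key]
    refine norm_add_le_of_le (norm_sub_le_of_le ?_ ?_) ?_
    · rwa [norm_smul, hc, one_mul]
    · exact (norm_cutoff_apply_le hY _).trans hβ
    · exact (norm_cutoff_apply_le hY _).trans ((norm_freeEvolution_apply_le t _).trans hα)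
  have h2 := norm_sub_norm_le (c • h) ((cutoff Y hY ∘L freeEvolution d t ∘L cutoff X hX) f)
  rw [norm_smul, hc, one_mul, hh] at h2
  have h3 := (cutoff Y hY ∘L freeEvolution d t ∘L cutoff X hX).le_opNorm f
  refine le_of_mul_le_mul_right ?_ hf
  linarith

theorem le_norm_cutoff_coord {δ ε t : ℝ} (hδ : 0 < δ) (hδ' : δ < 1) (hε : 0 < ε) (ht : 0 < t)
    (hlarge : 32768 / (ε ^ 4 * (1 - δ) ^ 2) ≤ t) {d : ℕ} (j : Fin d) {X Y : Set (Space d)}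
    (hX : MeasurableSet X) (hY : MeasurableSet Y) (hX' : {x | x j ≤ 0} ⊆ X)
    (hY' : {x | δ * t ≤ x j} ⊆ Y) :
    1 - ε ≤ ‖cutoff Y hY ∘L freeEvolution d t ∘L cutoff X hX‖ := by
  set e : Space d := EuclideanSpace.single j 1 with he
  set s := (1 + δ) / 2 with hs
  -- Inverse Lorentz factor: momentum `s / w` has energy `1 / w`, hence speed `s`.
  set w := √(1 - s ^ 2) with hw
  set M := (1 - δ) * t / 4 with hM
  have hδ1 : 0 < 1 - δ := by linarith
  have hMpos : 0 < M := by positivity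
  have hs1 : 0 < 1 - s ^ 2 := by nlinarith
  have hwpos : 0 < w := Real.sqrt_pos.mpr hs1
  have hwsq : w ^ 2 = 1 - s ^ 2 := Real.sq_sqrt hs1.le
  set η := ε ^ 2 / 64 with hη
  have hηpos : 0 < η := by positivity
  have hd : (0 : ℝ) < d := by exact_mod_cast j.pos
  -- Transverse widths grow with `d`, so that `∑ bᵢ = 2η / t` and the constant is independent of the
  -- dimension.
  set b : Fin d → ℝ := fun i => (if i = j then η / t else 0) + η / (t * d) with hbdef
  have hb : ∀ i, 0 < b i := fun i => by
    have h1 : 0 < η / (t * d) := by positivity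
    have h2 : 0 ≤ if i = j then η / t else 0 := by split_ifs <;> positivity
    simp only [hbdef]; linarith
  have hbj : η / t ≤ b j := by
    have h1 : 0 < η / (t * d) := by positivity
    simp only [hbdef, if_true]; linarith
  have hbsum : ∑ i, b i = 2 * η / t := by
    simp only [hbdef, Finset.sum_add_distrib, Finset.sum_ite_eq', Finset.mem_univ, if_true,
      Finset.sum_const, Finset.card_univ, Fintype.card_fin, nsmul_eq_mul]
    field_simp
    ring
  set κ : Space d := (2 * π)⁻¹ • (s / w) • e with hκ
  have hp : (2 * π) • κ = (s / w) • e := smul_inv_smul₀ (by positivity) _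
  have hbr : bracket ((2 * π) • κ) = 1 / w := by
    rw [hp, bracket, Real.sqrt_eq_iff_mul_self_eq (by positivity) (by positivity), norm_smul, he,
      PiLp.norm_single, norm_one, mul_one, Real.norm_eq_abs, sq_abs]
    field_simp
    linarith
  have hshift : (t / bracket ((2 * π) • κ)) • (2 * π) • κ = (t * s) • e := by
    rw [hbr, hp, smul_smul]
    congr 1
    field_simp
  have hej : e j = 1 := by simp [he]
  -- The only use of `hlarge`: each cutoff loses at most `ε / 4`. The dispersion error is `16η = (ε
  -- / 2)²` in squared norm.
  have hloss : 2 / (b j * M ^ 2) ≤ (ε / 4) ^ 2 := by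
    have h1 : 2 / (b j * M ^ 2) ≤ 2 / (η / t * M ^ 2) := by gcongr
    refine h1.trans ?_
    rw [div_le_iff₀ (by positivity)] at hlarge ⊢
    have h2 : (ε / 4) ^ 2 * (η / t * M ^ 2) = t * (ε ^ 4 * (1 - δ) ^ 2) / 16384 := by
      rw [hη, hM]; field_simp; norm_num
    rw [h2]; linarith
  have hroot : ∀ {u v N : ℝ}, 0 ≤ v → 0 ≤ N → u ^ 2 ≤ v ^ 2 * N ^ 2 → u ≤ v * N :=
    fun hv hN h => abs_le_of_sq_le_sq' (by rwa [mul_pow]) (mul_nonneg hv hN) |>.2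
  set a : Space d := (-M) • e with ha
  set a' : Space d := a + (t * s) • e with ha'
  have hN := norm_nonneg (packetLp hb κ a)
  have hNa' := norm_packetLp_eq hb κ a' a
  have hβ := freeEvolution_packetLp_sub hb ht.le κ a
  have hα := packetLp_sub_cutoff hb κ a hX (j := j) hMpos fun x hx => by
    have h1 : 0 < x j := not_le.mp fun h => hx (hX' h)
    have h2 : a j = -M := by rw [ha, PiLp.smul_apply, hej]; simp
    rw [h2]
    exact le_trans (by linarith) (le_abs_self _)
  have hγ := packetLp_sub_cutoff hb κ a' hY (j := j) hMpos fun x hx => by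
    have h1 : x j < δ * t := not_le.mp fun h => hx (hY' h)
    have h2 : a' j = -M + t * s := by
      rw [ha', ha, PiLp.add_apply, PiLp.smul_apply, PiLp.smul_apply, hej]; simp
    rw [h2]
    refine le_trans ?_ (neg_le_abs _)
    rw [hM, hs]
    linarith
  rw [hshift, hbsum] at hβ
  rw [hNa'] at hγ
  have hgoal := le_norm_cutoff_freeEvolution_cutoff hX hY (t := t) (α := ε / 4) (β := ε / 2)
    (γ := ε / 4) (f := packetLp hb κ a) (h := packetLp hb κ a') (by simp [Complex.norm_exp])
    (norm_packetLp_pos hb κ a) hNa'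
    (hroot (by positivity) hN (hα.trans (by gcongr)))
    (hroot (by positivity) hN (hβ.trans (le_of_eq (by rw [hη]; field_simp; norm_num))))
    (hroot (by positivity) hN (hγ.trans (by gcongr)))
  linarith

end PseudoRel

end

theorem propositionA1 (δ ε : ℝ) (hδ : 0 < δ) (hδ' : δ < 1) (hε : 0 < ε) :
    ∃ C : ℝ, 0 < C ∧ ∀ d : ℕ, 1 ≤ d → ∀ t : ℝ, 0 < t →
      ∃ (X Y : Set (PseudoRel.Space d)) (hX : MeasurableSet X) (hY : MeasurableSet Y),
        Convex ℝ X ∧ Convex ℝ Y ∧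
        PseudoRel.IsHalfSpace X ∧ PseudoRel.IsHalfSpace Y ∧
        PseudoRel.setDist X Y = δ * t ∧
        1 - ε - C / t ≤
          ‖PseudoRel.cutoff Y hY ∘L PseudoRel.freeEvolution d t ∘L PseudoRel.cutoff X hX‖ := by
  have hδ1 : 0 < 1 - δ := by linarith
  refine ⟨32768 / (ε ^ 4 * (1 - δ) ^ 2), by positivity, fun d hd t ht => ?_⟩
  set C := 32768 / (ε ^ 4 * (1 - δ) ^ 2) with hC
  have hCpos : 0 < C := by positivity
  have hX := PseudoRel.isHalfSpace_coord_le (⟨0, hd⟩ : Fin d) 0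
  have hY := PseudoRel.isHalfSpace_le_coord (⟨0, hd⟩ : Fin d) (δ * t)
  refine ⟨_, _, hX.measurableSet, hY.measurableSet, hX.convex, hY.convex, hX, hY,
    PseudoRel.setDist_coord _ (by positivity), ?_⟩
  have hCt : 0 < C / t := by positivity
  rcases le_total C t with h | h
  · have := PseudoRel.le_norm_cutoff_coord hδ hδ' hε ht h _ hX.measurableSet hY.measurableSet
      subset_rfl subset_rfl
    linarith
  -- For `t ≤ C` the claimed lower bound is negative.
  · have h1 : 1 ≤ C / t := (one_le_div ht).mpr h
    refine le_trans ?_ (norm_nonneg _)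
    linarith
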